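/- Theorem. Let $\alpha>1$, $C_0>0$ and $M>0$. Then there is a constant $C>0$, depending only on $\alpha$, $C_0$ and $M$, with the following property. Let $n\ge 1$, let $A\in\mathbb R^{n\times n}$, and let $W\in\mathbb R^{n\times n}$ be symmetric positive definite, with $(x,y)_W=x^\top Wy$ and $\|x\|_W=(x^\top Wx)^{1/2}$. Assume that the eigenvalues $\rho_1\ge\rho_2\ge\dots\ge\rho_n$ (counted with multiplicity) of the generalized eigenvalue problem $$(A\psi,Au)=\rho\,(\psi,u)_W\qquad\text{for all }u\in\mathbb R^n$$ satisfy $\rho_k\le C_0k^{-\alpha}$ for $k=1,\dots,n$. Let $x^*\in\mathbb R^n$ and $b=Ax^*+e$, where $e_1,\dots,e_n$ are independent mean-zero random variables that are sub-Gaussian with parameter $\sigma>0$, that is, $\mathbb E[\exp(te_i)]\le\exp(\tfrac12\sigma^2t^2)$ for all $t\in\mathbb R$. Put $$\rho_0=n^{-1/2}\|x^*\|_W+\sigma n^{-1/2},$$ and for $\lambda>0$ let $x_\lambda$ be the minimizer over $x\in\mathbb R^n$ of $\|Ax-b\|^2+\lambda\|x\|_W^2$, where $\|\cdot\|$ is the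 Euclidean norm. If $\lambda$ is at least of the order given by the parameter choice $\lambda^{1/2+1/(2\alpha)}\asymp\sigma n^{-1/2}\rho_0^{-1}$, in the sense that $$\sigma n^{-1/2}\rho_0^{-1}\le M\,\lambda^{\frac12+\frac1{2\alpha}},$$ then for every $z\ge 0$ $$\mathbb P\big(n^{-1/2}\|A(x_\lambda-x^*)\|\ge\lambda^{1/2}\rho_0z\big)\le 2e^{-Cz^2}\qquad\text{and}\qquad\mathbb P\big(n^{-1/2}\|x_\lambda\|_W\ge\rho_0z\big)\le 2e^{-Cz^2}.$$ -/

import Mathlib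

open MeasureTheory ProbabilityTheory
open scoped NNReal

/-- The action `x ↦ A x` of a square real matrix on `ℝⁿ`, where `ℝⁿ` carries the Euclidean norm. -/
noncomputable def matApply {n : ℕ} (A : Matrix (Fin n) (Fin n) ℝ)
    (x : EuclideanSpace ℝ (Fin n)) : EuclideanSpace ℝ (Fin n) :=
  WithLp.toLp 2 (A.mulVec x.ofLp)

/-- The bilinear form `(x, y)_W = xᵀ W y`. -/
noncomputable def wInner {n : ℕ} (W : Matrix (Fin n) (Fin n) ℝ)
    (x y : EuclideanSpace ℝ (Fin n)) : ℝ :=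
  dotProduct x.ofLp (W.mulVec y.ofLp)

/-- The weighted norm `‖x‖_W = (xᵀ W x)^{1/2}`. -/
noncomputable def wNorm {n : ℕ} (W : Matrix (Fin n) (Fin n) ℝ)
    (x : EuclideanSpace ℝ (Fin n)) : ℝ :=
  Real.sqrt (wInner W x x)

/-- The eigenspace of the generalized eigenvalue problem `(A ψ, A u) = r (ψ, u)_W` for all `u`. -/
def genEigenspace {n : ℕ} (A W : Matrix (Fin n) (Fin n) ℝ) (r : ℝ) :
    Submodule ℝ (EuclideanSpace ℝ (Fin n)) where
  carrier := {ψ | ∀ u : EuclideanSpace ℝ (Fin n),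
    inner ℝ (matApply A ψ) (matApply A u) = r * wInner W ψ u}
  zero_mem' := by
    intro u
    simp [matApply, wInner]
  add_mem' := by
    intro ψ φ hψ hφ u
    have h1 := hψ u
    have h2 := hφ u
    simp only [matApply, wInner, WithLp.ofLp_add, Matrix.mulVec_add, WithLp.toLp_add,
      inner_add_left, add_dotProduct, mul_add] at h1 h2 ⊢
    rw [h1, h2]
  smul_mem' := by
    intro c ψ hψ u
    have h1 := hψ u
    simp only [matApply, wInner, WithLp.ofLp_smul, Matrix.mulVec_smul, WithLp.toLp_smul,
      real_inner_smul_left, smul_dotProduct, smul_eq_mul] at h1 ⊢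
    rw [h1]
    ring

/-- `ρ 0 ≥ ρ 1 ≥ ⋯ ≥ ρ (n - 1)` is the list of the eigenvalues of the generalized eigenvalue
problem `(A ψ, A u) = r (ψ, u)_W` for all `u`, in decreasing order and repeated according to
multiplicity: every real number `r` occurs in the list as often as the dimension of its eigenspace
says (in particular not at all if it is not an eigenvalue). -/
def IsGenEigenvalueList {n : ℕ} (A W : Matrix (Fin n) (Fin n) ℝ) (ρ : Fin n → ℝ) : Prop :=
  Antitone ρ ∧ ∀ r : ℝ, Nat.card {k : Fin n // ρ k = r} = Module.finrank ℝ (genEigenspace A W r)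

/-- The eigenvalues of the generalized eigenvalue problem satisfy `ρ_k ≤ C₀ k^{-α}` for
`k = 1, …, n` (the `k`-th eigenvalue has index `k - 1` in `Fin n`). -/
def EigenvalueDecay {n : ℕ} (A W : Matrix (Fin n) (Fin n) ℝ) (α C₀ : ℝ) : Prop :=
  ∃ ρ : Fin n → ℝ, IsGenEigenvalueList A W ρ ∧
    ∀ k : Fin n, ρ k ≤ C₀ * (((k : ℕ) : ℝ) + 1) ^ (-α)

/-- The components of the noise vector are independent, of mean zero, and sub-Gaussian with
parameter `σ`: `E[exp (t (e_i - E e_i))] ≤ exp (σ² t² / 2)` for all real `t`. -/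
structure IsSubGaussianNoise {n : ℕ} {Ω : Type*} [MeasurableSpace Ω] (P : Measure Ω) (σ : ℝ≥0)
    (e : Ω → EuclideanSpace ℝ (Fin n)) : Prop where
  measurable : ∀ i, Measurable (fun ω => e ω i)
  indep : iIndepFun (fun i ω => e ω i) P
  mean_zero : ∀ i, ∫ ω, e ω i ∂P = 0
  subGaussian : ∀ i, HasSubgaussianMGF (fun ω => e ω i - ∫ ω', e ω' i ∂P) (σ ^ 2) P

/-- The weighted Tikhonov functional `x ↦ ‖A x - b‖² + lam ‖x‖_W²`. -/
noncomputable def tikhonov {n : ℕ} (A W : Matrix (Fin n) (Fin n) ℝ) (lam : ℝ)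
    (b x : EuclideanSpace ℝ (Fin n)) : ℝ :=
  ‖matApply A x - b‖ ^ 2 + lam * wNorm W x ^ 2

/-- `x` minimizes the Tikhonov functional with data `b` over all of `ℝⁿ`. -/
def IsTikhonovMinimizer {n : ℕ} (A W : Matrix (Fin n) (Fin n) ℝ) (lam : ℝ)
    (b x : EuclideanSpace ℝ (Fin n)) : Prop :=
  ∀ y : EuclideanSpace ℝ (Fin n), tikhonov A W lam b x ≤ tikhonov A W lam b y

/-- `ρ₀ = n^{-1/2} ‖x*‖_W + σ n^{-1/2}`. -/
noncomputable def rhoZero {n : ℕ} (W : Matrix (Fin n) (Fin n) ℝ)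
    (xstar : EuclideanSpace ℝ (Fin n)) (σ : ℝ≥0) : ℝ :=
  wNorm W xstar / Real.sqrt n + (σ : ℝ) / Real.sqrt n

/-! In a `W`-orthonormal basis `u k` of generalized eigenvectors the problem decouples: the
minimizer has `k`-th coordinate `(ν k * d k + g k) / (ν k + lam)`, where `d k` is that of `xstar`
and `g k` is the inner product of `A (u k)` with the noise. Squared errors thus split into a bias,
at most `lam * ‖xstar‖_W²` (or `‖xstar‖_W²` for the norm of the minimizer), and a quadratic form in
the noise.

The trace of that form is at most the effective dimension `∑ ν k / (ν k + lam)` (divided by `lam`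
for the norm), which eigenvalue decay bounds by a multiple of `lam ^ (-1/α)`
(`sum_div_add_le_of_decay`). A tail bound that sees only the trace suffices
(`IsSubGaussianNoise.measureReal_sum_inner_sq_ge_le`), and the parameter choice says exactly that
`σ²` times the trace is of order `lam * ρ₀² * n`, respectively `ρ₀² * n`. -/

/-! ### Generalized eigenbasis and multiplicities -/

open Matrix in
theorem Matrix.IsHermitian.exists_orthogonal_diagonalization {n : ℕ}
    {S : Matrix (Fin n) (Fin n) ℝ} (hS : S.IsHermitian) :
    ∃ V : Matrix (Fin n) (Fin n) ℝ, Vᵀ * V = 1 ∧ Vᵀ * S * V = diagonal hS.eigenvalues := by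
  refine ⟨hS.eigenvectorUnitary, ?_, ?_⟩
  · simpa [star_eq_conjTranspose] using
      Unitary.coe_star_mul_self hS.eigenvectorUnitary
  · have h := hS.conjStarAlgAut_star_eigenvectorUnitary
    rw [Unitary.conjStarAlgAut_star_apply] at h
    rw [star_eq_conjTranspose, conjTranspose_eq_transpose_of_trivial] at h
    rw [h]
    rfl

-- Whiten `W` by `T`; an orthogonal diagonalization of `Tᵀ * S * T` then leaves the identity form
-- unchanged.
open Matrix in
theorem Matrix.PosDef.exists_simultaneous_diagonalization {n : ℕ}
    {W S : Matrix (Fin n) (Fin n) ℝ} (hW : W.PosDef) (hS : S.IsHermitian) :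
    ∃ (U : Matrix (Fin n) (Fin n) ℝ) (ν : Fin n → ℝ),
      Uᵀ * W * U = 1 ∧ Uᵀ * S * U = diagonal ν := by
  obtain ⟨V, -, hV⟩ := hW.isHermitian.exists_orthogonal_diagonalization
  set D : Matrix (Fin n) (Fin n) ℝ := diagonal fun i => (√(hW.isHermitian.eigenvalues i))⁻¹
  set T := V * D with hT
  have hTW : Tᵀ * W * T = 1 := by
    have : Tᵀ * W * T = D * (Vᵀ * W * V) * D := by
      simp only [hT, transpose_mul, D, diagonal_transpose, Matrix.mul_assoc]
    rw [this, hV, diagonal_mul_diagonal, diagonal_mul_diagonal, ← diagonal_one]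
    congr 1
    ext i
    have hpos := hW.eigenvalues_pos i
    have hs := Real.sqrt_pos.2 hpos
    have hsq := Real.mul_self_sqrt hpos.le
    field_simp
    linarith [hsq]
  have hTS : (Tᵀ * S * T).IsHermitian := by
    simpa using isHermitian_conjTranspose_mul_mul T hS
  obtain ⟨Q, hQ, hQS⟩ := hTS.exists_orthogonal_diagonalization
  refine ⟨T * Q, hTS.eigenvalues, ?_, ?_⟩
  · calc (T * Q)ᵀ * W * (T * Q) = Qᵀ * (Tᵀ * W * T) * Q := by
          simp only [transpose_mul, Matrix.mul_assoc]
      _ = 1 := by rw [hTW, Matrix.mul_one, hQ]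
  · rw [← hQS]
    simp only [transpose_mul, Matrix.mul_assoc]

theorem Matrix.IsSymm.dotProduct_mulVec_comm {n : ℕ} {S : Matrix (Fin n) (Fin n) ℝ}
    (hS : S.IsSymm) (x y : Fin n → ℝ) :
    x ⬝ᵥ S.mulVec y = y ⬝ᵥ S.mulVec x := by
  rw [Matrix.dotProduct_mulVec, ← Matrix.mulVec_transpose, hS.eq, dotProduct_comm]

theorem inner_matApply {n : ℕ} (A : Matrix (Fin n) (Fin n) ℝ) (x y : EuclideanSpace ℝ (Fin n)) :
    inner ℝ (matApply A x) (matApply A y) = x.ofLp ⬝ᵥ (A.transpose * A).mulVec y.ofLp := by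
  rw [← Matrix.mulVec_mulVec, Matrix.dotProduct_mulVec, Matrix.vecMul_transpose,
    EuclideanSpace.inner_eq_star_dotProduct, dotProduct_comm]
  simp [matApply]

theorem mem_genEigenspace_iff {n : ℕ} {A W : Matrix (Fin n) (Fin n) ℝ} (hW : W.IsSymm) {r : ℝ}
    {ψ : EuclideanSpace ℝ (Fin n)} :
    ψ ∈ genEigenspace A W r ↔ (A.transpose * A - r • W).mulVec ψ.ofLp = 0 := by
  change (∀ u : EuclideanSpace ℝ (Fin n), _ = _) ↔ _
  have key : ∀ u : EuclideanSpace ℝ (Fin n),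
      inner ℝ (matApply A ψ) (matApply A u) = r * wInner W ψ u ↔
        u.ofLp ⬝ᵥ (A.transpose * A - r • W).mulVec ψ.ofLp = 0 := by
    intro u
    rw [inner_matApply, wInner, hW.dotProduct_mulVec_comm,
      (Matrix.isSymm_transpose_mul_self A).dotProduct_mulVec_comm, Matrix.sub_mulVec,
      Matrix.smul_mulVec, dotProduct_sub, dotProduct_smul, smul_eq_mul, sub_eq_zero]
  simp only [key]
  refine ⟨fun h => ?_, fun h u => by rw [h, dotProduct_zero]⟩
  exact dotProduct_self_eq_zero.1 (h (WithLp.toLp 2 _))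

/-- Congruence by the invertible `U` turns `AᵀA - r W` into the diagonal matrix of `ν k - r`, whose
rank counts the `k` with `ν k ≠ r`; rank-nullity does the rest. -/
theorem finrank_genEigenspace {n : ℕ} {A W U : Matrix (Fin n) (Fin n) ℝ} {ν : Fin n → ℝ}
    (hW : W.IsSymm) (hUW : U.transpose * W * U = 1)
    (hUA : U.transpose * (A.transpose * A) * U = Matrix.diagonal ν) (r : ℝ) :
    Module.finrank ℝ (genEigenspace A W r) = Nat.card {k // ν k = r} := by
  have hdet : IsUnit U.det := by
    rw [← Matrix.isUnit_iff_isUnit_det]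
    exact IsUnit.of_mul_eq_one_right _ hUW
  have hdetT : IsUnit U.transpose.det := by rwa [Matrix.det_transpose]
  have hmap : (genEigenspace A W r).map (WithLp.linearEquiv 2 ℝ (Fin n → ℝ)).toLinearMap =
      LinearMap.ker (A.transpose * A - r • W).mulVecLin := by
    ext x
    simp only [Submodule.mem_map, LinearMap.mem_ker, Matrix.mulVecLin_apply,
      mem_genEigenspace_iff hW]
    constructor
    · rintro ⟨y, hy, rfl⟩
      exact hy
    · intro hx
      exact ⟨WithLp.toLp 2 x, hx, rfl⟩
  have hrank : (A.transpose * A - r • W).rank = Fintype.card {k // ν k ≠ r} := by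
    rw [← Matrix.rank_mul_eq_right_of_isUnit_det _ _ hdetT,
      ← Matrix.rank_mul_eq_left_of_isUnit_det _ _ hdet, Matrix.mul_sub, Matrix.sub_mul, hUA,
      Matrix.mul_smul, Matrix.smul_mul, hUW, Matrix.smul_one_eq_diagonal, Matrix.diagonal_sub,
      Matrix.rank_diagonal]
    simp only [ne_eq, sub_eq_zero]
  have hsum := LinearMap.finrank_range_add_finrank_ker (A.transpose * A - r • W).mulVecLin
  rw [← hmap, LinearEquiv.finrank_map_eq] at hsum
  change (A.transpose * A - r • W).rank + _ = _ at hsum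
  rw [hrank, Module.finrank_fin_fun] at hsum
  have hcard := Fintype.card_subtype_compl fun k => ν k = r
  have hle := Fintype.card_subtype_le fun k => ν k = r
  rw [Fintype.card_fin] at hcard hle
  rw [Nat.card_eq_fintype_card]
  change _ + _ = _ at hsum
  simp only [ne_eq] at hsum
  rw [hcard] at hsum
  exact Nat.add_left_cancel (hsum.trans (Nat.sub_add_cancel hle).symm)

/-- Decay is known for the given list `ρ`, while coordinates use the `ν` of the constructed basis.
Matching fibers carries the trace from one to the other without sorting `ν`. -/
theorem sum_comp_eq_of_card_fiber_eq {ι κ β : Type*} [Fintype ι] [Fintype κ] {f : ι → β}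
    {g : κ → β} (h : ∀ r, Nat.card {i // f i = r} = Nat.card {k // g k = r}) (φ : β → ℝ) :
    ∑ i, φ (f i) = ∑ k, φ (g k) := by
  have E' : ∀ r, Nonempty ({i // f i = r} ≃ {k // g k = r}) := fun r =>
    Finite.card_eq.1 (h r)
  let E := Equiv.ofFiberEquiv fun r => (E' r).some
  rw [← E.sum_comp]
  exact Finset.sum_congr rfl fun i _ => congrArg φ (Equiv.ofFiberEquiv_map _ i).symm

/-- A basis of eigenvectors of the generalized eigenvalue problem, orthonormal for `wInner W`. -/
theorem exists_genEigenbasis {n : ℕ} {A W : Matrix (Fin n) (Fin n) ℝ} (hW : W.PosDef) :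
    ∃ (u : Fin n → EuclideanSpace ℝ (Fin n)) (ν : Fin n → ℝ),
      (∀ r, Module.finrank ℝ (genEigenspace A W r) = Nat.card {k // ν k = r}) ∧
      (∀ k v, inner ℝ (matApply A (u k)) (matApply A v) = ν k * wInner W (u k) v) ∧
      (∀ k, ν k = ‖matApply A (u k)‖ ^ 2) ∧
      (∀ x, wInner W x x = ∑ k, wInner W (u k) x ^ 2) ∧
      ∀ x, ‖matApply A x‖ ^ 2 = ∑ k, ν k * wInner W (u k) x ^ 2 := by
  have hWs : W.IsSymm := by simpa [Matrix.IsHermitian, Matrix.IsSymm] using hW.isHermitian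
  obtain ⟨U, ν, hUW, hUA⟩ := hW.exists_simultaneous_diagonalization
    (S := A.transpose * A) (by simpa using Matrix.isHermitian_conjTranspose_mul_self A)
  have hUU : U * (U.transpose * W) = 1 := by
    rw [mul_eq_one_comm, hUW]
  have hc : ∀ x k, wInner W (WithLp.toLp 2 (U.transpose k)) x
      = (U.transpose * W).mulVec x.ofLp k := by
    intro x k
    rw [wInner, ← Matrix.mulVec_mulVec]
    rfl
  have hrec : ∀ x : EuclideanSpace ℝ (Fin n),
      U.mulVec (fun k => wInner W (WithLp.toLp 2 (U.transpose k)) x) = x.ofLp := by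
    intro x
    rw [funext (hc x), Matrix.mulVec_mulVec, hUU, Matrix.one_mulVec]
  have hform : ∀ (S : Matrix (Fin n) (Fin n) ℝ) (c d : Fin n → ℝ),
      U.mulVec c ⬝ᵥ S.mulVec (U.mulVec d) = c ⬝ᵥ (U.transpose * S * U).mulVec d := by
    intro S c d
    rw [Matrix.mul_assoc, ← Matrix.mulVec_mulVec, Matrix.dotProduct_mulVec c,
      Matrix.vecMul_transpose, Matrix.mulVec_mulVec]
  have hA : ∀ x y, inner ℝ (matApply A x) (matApply A y) =
      ∑ k, wInner W (WithLp.toLp 2 (U.transpose k)) x *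
        (ν k * wInner W (WithLp.toLp 2 (U.transpose k)) y) := by
    intro x y
    rw [inner_matApply, ← hrec x, ← hrec y, hform, hUA, dotProduct]
    simp only [Matrix.mulVec_diagonal]
  have hort : ∀ j k, wInner W (WithLp.toLp 2 (U.transpose j)) (WithLp.toLp 2 (U.transpose k))
      = (1 : Matrix (Fin n) (Fin n) ℝ) j k := by
    intro j k
    rw [hc, ← hUW]
    rfl
  have hB : ∀ k v, inner ℝ (matApply A (WithLp.toLp 2 (U.transpose k))) (matApply A v)
      = ν k * wInner W (WithLp.toLp 2 (U.transpose k)) v := by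
    intro k v
    rw [hA]
    simp [hort, Matrix.one_apply]
  refine ⟨fun k => WithLp.toLp 2 (U.transpose k), ν, finrank_genEigenspace hWs hUW hUA, hB, ?_, ?_,
    ?_⟩
  · intro k
    rw [← real_inner_self_eq_norm_sq, hB, hort, Matrix.one_apply_eq, mul_one]
  · intro x
    conv_lhs => rw [wInner, ← hrec x, hform, hUW, Matrix.one_mulVec, dotProduct]
    exact Finset.sum_congr rfl fun k _ => by ring
  · intro x
    rw [← real_inner_self_eq_norm_sq, hA]
    exact Finset.sum_congr rfl fun k _ => by ring

/-! ### Sub-Gaussian exponential moments and tails -/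

theorem lintegral_exp_neg_mul_sq {b : ℝ} (hb : 0 < b) :
    ∫⁻ t : ℝ, ENNReal.ofReal (Real.exp (-b * t ^ 2)) = ENNReal.ofReal √(Real.pi / b) := by
  rw [← integral_gaussian, ofReal_integral_eq_lintegral_ofReal (integrable_exp_neg_mul_sq hb)
    (ae_of_all _ fun t => (Real.exp_pos _).le)]

theorem lintegral_exp_linear_sub_sq {a : ℝ} (ha : 0 < a) (y : ℝ) :
    ∫⁻ t : ℝ, ENNReal.ofReal (Real.exp (t * y - a * t ^ 2)) =
      ENNReal.ofReal (Real.exp (y ^ 2 / (4 * a))) * ENNReal.ofReal √(Real.pi / a) := by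
  have h : ∀ t : ℝ, ENNReal.ofReal (Real.exp (t * y - a * t ^ 2)) =
      ENNReal.ofReal (Real.exp (y ^ 2 / (4 * a))) *
        ENNReal.ofReal (Real.exp (-a * (t - y / (2 * a)) ^ 2)) := by
    intro t
    rw [← ENNReal.ofReal_mul (Real.exp_pos _).le, ← Real.exp_add]
    congr 2
    field_simp
    ring
  simp only [h]
  rw [lintegral_const_mul' _ _ ENNReal.ofReal_ne_top,
    lintegral_sub_right_eq_self (fun t : ℝ => ENNReal.ofReal (Real.exp (-a * t ^ 2))),
    lintegral_exp_neg_mul_sq ha]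

/-- Completing the square writes `exp (y² / (4a))` as a Gaussian average over `t` of `exp (t y)`.
After Tonelli the moment generating function bound applies for each `t`. -/
theorem ProbabilityTheory.HasSubgaussianMGF.lintegral_exp_sq_le {Ω : Type*} [MeasurableSpace Ω]
    {P : Measure Ω} [IsProbabilityMeasure P] {Y : Ω → ℝ} {v : ℝ≥0} (hY : HasSubgaussianMGF Y v P)
    (hm : Measurable Y) (hv : 0 < v) :
    ∫⁻ ω, ENNReal.ofReal (Real.exp (3 / 8 * (Y ω ^ 2 / v))) ∂P ≤ 2 := by
  have hv' : (0 : ℝ) < v := hv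
  -- With this `a`, `1 / (4a) = 3 / (8v)` and `a - v/2 = v/6 = a/4`, so the ratio of the two
  -- Gaussian integrals is exactly `2`.
  set a : ℝ := 2 * v / 3 with ha_def
  have ha : 0 < a := by positivity
  set K := ENNReal.ofReal √(Real.pi / a)
  have hK0 : K ≠ 0 := by
    have : 0 < √(Real.pi / a) := Real.sqrt_pos.2 (div_pos Real.pi_pos ha)
    simpa [K] using this
  have hKtop : K ≠ ⊤ := ENNReal.ofReal_ne_top
  rw [← ENNReal.mul_le_mul_iff_left hK0 hKtop]
  calc (∫⁻ ω, ENNReal.ofReal (Real.exp (3 / 8 * (Y ω ^ 2 / v))) ∂P) * K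
      = ∫⁻ ω, ∫⁻ t : ℝ, ENNReal.ofReal (Real.exp (t * Y ω - a * t ^ 2)) ∂volume ∂P := by
        rw [← lintegral_mul_const' _ _ hKtop]
        refine lintegral_congr fun ω => ?_
        rw [lintegral_exp_linear_sub_sq ha]
        congr 3
        rw [ha_def]
        field_simp
        ring
    _ = ∫⁻ t : ℝ, ∫⁻ ω, ENNReal.ofReal (Real.exp (t * Y ω - a * t ^ 2)) ∂P :=
        lintegral_lintegral_swap (by fun_prop)
    _ ≤ ∫⁻ t : ℝ, ENNReal.ofReal (Real.exp (-(v / 6) * t ^ 2)) := by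
        refine lintegral_mono fun t => ?_
        rw [← ofReal_integral_eq_lintegral_ofReal]
        · refine ENNReal.ofReal_le_ofReal ?_
          simp only [sub_eq_add_neg, Real.exp_add]
          rw [integral_mul_const]
          calc _ ≤ Real.exp (v * t ^ 2 / 2) * Real.exp (-(a * t ^ 2)) :=
                mul_le_mul_of_nonneg_right (hY.mgf_le t) (Real.exp_pos _).le
            _ = _ := by
                rw [← Real.exp_add, ha_def]
                congr 1
                ring
        · simp only [sub_eq_add_neg, Real.exp_add]
          exact (hY.integrable_exp_mul t).mul_const _
        · exact ae_of_all _ fun ω => (Real.exp_pos _).le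
    _ = 2 * K := by
        rw [lintegral_exp_neg_mul_sq (by positivity)]
        have : √(Real.pi / (v / 6)) = 2 * √(Real.pi / a) := by
          rw [show Real.pi / (v / 6) = 2 ^ 2 * (Real.pi / a) by rw [ha_def]; field_simp; norm_num,
            Real.sqrt_mul (by positivity), Real.sqrt_sq (by norm_num)]
        rw [this, ENNReal.ofReal_mul (by norm_num)]
        simp [K]

theorem IsSubGaussianNoise.hasSubgaussianMGF_inner {n : ℕ} {Ω : Type*} [MeasurableSpace Ω]
    {P : Measure Ω} [IsProbabilityMeasure P] {σ : ℝ≥0} {e : Ω → EuclideanSpace ℝ (Fin n)}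
    (he : IsSubGaussianNoise P σ e) (b : EuclideanSpace ℝ (Fin n)) :
    HasSubgaussianMGF (fun ω => inner ℝ b (e ω)) (‖b‖₊ ^ 2 * σ ^ 2) P := by
  have hsub : ∀ i, HasSubgaussianMGF (fun ω => e ω i) (σ ^ 2) P := by
    intro i
    simpa [he.mean_zero i] using he.subGaussian i
  have hind : iIndepFun (fun i ω => b i * e ω i) P :=
    he.indep.comp (fun i x => b i * x) fun i => by fun_prop
  have h := HasSubgaussianMGF.sum_of_iIndepFun hind (s := Finset.univ)
    fun i _ => (hsub i).const_mul (b i)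
  convert h using 1
  · ext ω
    simp [PiLp.inner_apply, mul_comm]
  · ext
    rw [NNReal.coe_sum]
    change ‖b‖ ^ 2 * (σ : ℝ) ^ 2 = ∑ i, b i ^ 2 * (σ : ℝ) ^ 2
    rw [← Finset.sum_mul, EuclideanSpace.real_norm_sq_eq]

theorem IsSubGaussianNoise.measurable_inner {n : ℕ} {Ω : Type*} [MeasurableSpace Ω]
    {P : Measure Ω} {σ : ℝ≥0} {e : Ω → EuclideanSpace ℝ (Fin n)}
    (he : IsSubGaussianNoise P σ e) (b : EuclideanSpace ℝ (Fin n)) :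
    Measurable fun ω => inner ℝ b (e ω) := by
  simp only [PiLp.inner_apply]
  exact Finset.measurable_sum _ fun i _ => (he.measurable i).mul_const (b i)

/-- Tail bound for a quadratic form in sub-Gaussian noise, in terms of its trace. -/
theorem IsSubGaussianNoise.measureReal_sum_inner_sq_ge_le {n : ℕ} {Ω : Type*} [MeasurableSpace Ω]
    {P : Measure Ω} [IsProbabilityMeasure P] {σ : ℝ≥0} {e : Ω → EuclideanSpace ℝ (Fin n)}
    (he : IsSubGaussianNoise P σ e) (hσ : 0 < σ) {ι : Type*} [Fintype ι]
    (b : ι → EuclideanSpace ℝ (Fin n)) {S t : ℝ} (hS : ∑ k, ‖b k‖ ^ 2 ≤ S)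
    (ht : 0 ≤ t) :
    P.real {ω | t ≤ ∑ k, inner ℝ (b k) (e ω) ^ 2} ≤
      2 * Real.exp (-(3 / 8 * (t / (σ ^ 2 * S)))) := by
  have hσ' : (0 : ℝ) < σ := hσ
  set T := ∑ k, ‖b k‖ ^ 2 with hT
  have hT0 : 0 ≤ T := Finset.sum_nonneg fun k _ => sq_nonneg _
  rcases hT0.eq_or_lt with hT0 | hT0
  · have hb : ∀ k, b k = 0 := fun k => by
      simpa using (Finset.sum_eq_zero_iff_of_nonneg fun k _ => sq_nonneg ‖b k‖).1 hT0.symm k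
        (Finset.mem_univ k)
    rcases ht.eq_or_lt with rfl | ht
    · simpa using measureReal_le_one.trans one_le_two
    · simp [hb, not_le.2 ht]
      positivity
  -- Jensen with weights `‖b k‖² / T` reduces the form to single normalized linear forms, each with
  -- exponential moment at most `2`. The forms need not be independent of each other.
  have hpoint : ∀ ω, Real.exp (3 / 8 * ((∑ k, inner ℝ (b k) (e ω) ^ 2) / (σ ^ 2 * T))) ≤
      ∑ k, ‖b k‖ ^ 2 / T *
        Real.exp (3 / 8 * (inner ℝ (b k) (e ω) ^ 2 / (‖b k‖ ^ 2 * σ ^ 2))) := by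
    intro ω
    have h := convexOn_exp.map_sum_le (t := Finset.univ) (w := fun k => ‖b k‖ ^ 2 / T)
      (p := fun k => 3 / 8 * (inner ℝ (b k) (e ω) ^ 2 / (‖b k‖ ^ 2 * σ ^ 2)))
      (fun k _ => by positivity) (by rw [← Finset.sum_div, div_self hT0.ne'])
      (fun k _ => Set.mem_univ _)
    simp only [smul_eq_mul] at h
    refine le_of_eq_of_le ?_ h
    rw [Finset.sum_div, Finset.mul_sum]
    congr 1
    refine Finset.sum_congr rfl fun k _ => ?_
    by_cases hk : b k = 0
    · simp [hk]
    · have : 0 < ‖b k‖ := norm_pos_iff.2 hk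
      field_simp
  have hmean : ∫⁻ ω, ENNReal.ofReal
      (Real.exp (3 / 8 * ((∑ k, inner ℝ (b k) (e ω) ^ 2) / (σ ^ 2 * T)))) ∂P ≤ 2 := by
    calc _ ≤ ∫⁻ ω, ∑ k, ENNReal.ofReal (‖b k‖ ^ 2 / T) * ENNReal.ofReal
          (Real.exp (3 / 8 * (inner ℝ (b k) (e ω) ^ 2 / (‖b k‖ ^ 2 * σ ^ 2)))) ∂P := by
          refine lintegral_mono fun ω => ?_
          refine (ENNReal.ofReal_le_ofReal (hpoint ω)).trans_eq ?_
          rw [ENNReal.ofReal_sum_of_nonneg fun k _ => by positivity]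
          exact Finset.sum_congr rfl fun k _ => ENNReal.ofReal_mul (by positivity)
      _ = ∑ k, ENNReal.ofReal (‖b k‖ ^ 2 / T) * ∫⁻ ω, ENNReal.ofReal
          (Real.exp (3 / 8 * (inner ℝ (b k) (e ω) ^ 2 / (‖b k‖ ^ 2 * σ ^ 2)))) ∂P := by
          rw [lintegral_finsetSum _ fun k _ => ((((((he.measurable_inner (b k)).pow_const 2).div_const
            _).const_mul _).exp).ennreal_ofReal).const_mul _]
          exact Finset.sum_congr rfl fun k _ => lintegral_const_mul' _ _ ENNReal.ofReal_ne_top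
      _ ≤ ∑ k, ENNReal.ofReal (‖b k‖ ^ 2 / T) * 2 := by
          refine Finset.sum_le_sum fun k _ => ?_
          by_cases hk : b k = 0
          · simp [hk]
          · have hk' : 0 < ‖b k‖₊ := by simpa [pos_iff_ne_zero] using hk
            have h := (he.hasSubgaussianMGF_inner (b k)).lintegral_exp_sq_le
              (he.measurable_inner _) (by positivity)
            push_cast at h
            gcongr
      _ = 2 := by
          rw [← Finset.sum_mul, ← ENNReal.ofReal_sum_of_nonneg fun k _ => by positivity,
            ← Finset.sum_div, div_self hT0.ne']
          simp
  set c := Real.exp (3 / 8 * (t / (σ ^ 2 * T))) with hc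
  have hcpos : 0 < c := Real.exp_pos _
  have hmarkov : ENNReal.ofReal c * P {ω | t ≤ ∑ k, inner ℝ (b k) (e ω) ^ 2} ≤ 2 := by
    refine le_trans ?_ (le_trans (mul_meas_ge_le_lintegral₀ (f := fun ω => ENNReal.ofReal
      (Real.exp (3 / 8 * ((∑ k, inner ℝ (b k) (e ω) ^ 2) / (σ ^ 2 * T))))) ?_
      (ENNReal.ofReal c)) hmean)
    · gcongr with ω
      intro hω
      exact ENNReal.ofReal_le_ofReal (by rw [hc]; gcongr)
    · exact ((((Finset.measurable_sum _ fun k _ => (he.measurable_inner (b k)).pow_const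
        2).div_const _).const_mul _).exp).ennreal_ofReal.aemeasurable
  have hreal : c * P.real {ω | t ≤ ∑ k, inner ℝ (b k) (e ω) ^ 2} ≤ 2 := by
    have := ENNReal.toReal_mono (by simp) hmarkov
    rwa [ENNReal.toReal_mul, ENNReal.toReal_ofReal hcpos.le] at this
  calc P.real {ω | t ≤ ∑ k, inner ℝ (b k) (e ω) ^ 2} ≤ 2 * c⁻¹ := by
        rw [← div_eq_mul_inv, le_div_iff₀ hcpos, mul_comm]
        exact hreal
    _ ≤ _ := by
        rw [hc, ← Real.exp_neg]
        gcongr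

/-! ### Bounding the effective dimension -/

/-- Discrete integral comparison: the right side is the integral of the decreasing function `(1 +
x/m) ^ (-α)` over `[k, k+1]`. The proof uses only `log y ≥ 1 - 1/y` and `exp y ≥ 1 + y`. -/
theorem one_add_rpow_neg_le_telescope {α m : ℝ} (hα : 1 < α) (hm : 0 < m) (k : ℕ) :
    (1 + ((k : ℝ) + 1) / m) ^ (-α) ≤
      m / (α - 1) * ((1 + (k : ℝ) / m) ^ (1 - α) - (1 + ((k : ℝ) + 1) / m) ^ (1 - α)) := by
  have hα' : 0 < α - 1 := by linarith
  set a := 1 + (k : ℝ) / m with ha_def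
  set b := 1 + ((k : ℝ) + 1) / m with hb_def
  have ha : 0 < a := by positivity
  have hb : 0 < b := by positivity
  have hba : b - a = 1 / m := by rw [ha_def, hb_def]; ring
  have hratio : 1 + (α - 1) * (1 - a / b) ≤ (b / a) ^ (α - 1) := by
    rw [Real.rpow_def_of_pos (div_pos hb ha)]
    have h1 := Real.one_sub_inv_le_log_of_pos (div_pos hb ha)
    rw [inv_div] at h1
    have h2 := Real.add_one_le_exp (Real.log (b / a) * (α - 1))
    nlinarith
  have hbα : b ^ (-α) = b ^ (1 - α) / b := by
    rw [show -α = (1 - α) - 1 by ring, Real.rpow_sub_one hb.ne']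
  have haα : a ^ (1 - α) = (b / a) ^ (α - 1) * b ^ (1 - α) := by
    rw [show 1 - α = -(α - 1) by ring, Real.div_rpow hb.le ha.le, Real.rpow_neg ha.le,
      Real.rpow_neg hb.le]
    have := Real.rpow_pos_of_pos hb (α - 1)
    field_simp
  have hbpos := Real.rpow_pos_of_pos hb (1 - α)
  have h3 : (1 + (α - 1) * (1 - a / b)) * b ^ (1 - α) ≤ a ^ (1 - α) := by
    rw [haα]
    gcongr
  have h4 : 1 - a / b = 1 / (m * b) := by
    rw [eq_div_iff (by positivity)]
    field_simp
    rw [hba]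
    field_simp
  rw [h4] at h3
  rw [hbα, div_mul_eq_mul_div, le_div_iff₀ hα']
  have h5 : b ^ (1 - α) / b * (α - 1) = m * ((α - 1) * (1 / (m * b)) * b ^ (1 - α)) := by
    field_simp
  rw [h5]
  gcongr
  linarith

theorem sum_one_add_rpow_neg_le {α m : ℝ} (hα : 1 < α) (hm : 0 < m) (n : ℕ) :
    ∑ k : Fin n, (1 + ((k : ℕ) + 1 : ℝ) / m) ^ (-α) ≤ m / (α - 1) := by
  have hα' : 0 < α - 1 := by linarith
  rw [Fin.sum_univ_eq_sum_range fun k : ℕ => (1 + ((k : ℝ) + 1) / m) ^ (-α)]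
  refine (Finset.sum_le_sum fun k _ => one_add_rpow_neg_le_telescope hα hm k).trans ?_
  rw [← Finset.mul_sum]
  have h := Finset.sum_range_sub' (fun k : ℕ => (1 + (k : ℝ) / m) ^ (1 - α)) n
  push_cast at h
  rw [h]
  have hn : 0 < (1 + (n : ℝ) / m) ^ (1 - α) := by positivity
  simp only [zero_div, add_zero, Real.one_rpow]
  have : 0 < m / (α - 1) := by positivity
  nlinarith

theorem one_div_one_add_rpow_le {α x : ℝ} (hα : 1 < α) (hx : 0 ≤ x) :
    1 / (1 + x ^ α) ≤ 2 ^ α * (1 + x) ^ (-α) := by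
  have hx1 : 0 < (1 + x) ^ α := by positivity
  rw [Real.rpow_neg (by positivity), ← div_eq_mul_inv, div_le_div_iff₀ (by positivity) hx1, one_mul]
  calc (1 + x) ^ α ≤ (2 * max 1 x) ^ α := by
        gcongr
        linarith [le_max_left 1 x, le_max_right 1 x]
    _ = 2 ^ α * max 1 x ^ α := Real.mul_rpow (by norm_num) (by positivity)
    _ ≤ 2 ^ α * (1 + x ^ α) := by
        gcongr
        have := Real.rpow_nonneg hx α
        rcases max_cases 1 x with ⟨h, -⟩ | ⟨h, -⟩ <;> (rw [h]; simp [this])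

/-- The effective dimension of the regularized problem is at most of order `lam ^ (-1 / α)`. -/
theorem sum_div_add_le_of_decay {α C₀ lam : ℝ} (hα : 1 < α) (hC₀ : 0 < C₀) (hlam : 0 < lam)
    {n : ℕ} {ρ : Fin n → ℝ} (h0 : ∀ k, 0 ≤ ρ k)
    (hρ : ∀ k : Fin n, ρ k ≤ C₀ * (((k : ℕ) : ℝ) + 1) ^ (-α)) :
    ∑ k, ρ k / (ρ k + lam) ≤ 2 ^ α * C₀ ^ (1 / α) / (α - 1) * lam ^ (-(1 / α)) := by
  -- The index at which the decay bound `C₀ * k ^ (-α)` crosses `lam`; beyond it the summands decay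
  -- like `(k/m) ^ (-α)`.
  set m := (C₀ / lam) ^ (1 / α) with hm_def
  have hm : 0 < m := by positivity
  have hmα : m ^ α = C₀ / lam := by
    rw [hm_def, ← Real.rpow_mul (by positivity), one_div_mul_cancel (by linarith), Real.rpow_one]
  calc ∑ k, ρ k / (ρ k + lam) ≤ ∑ k : Fin n, 2 ^ α * (1 + ((k : ℕ) + 1 : ℝ) / m) ^ (-α) := by
        refine Finset.sum_le_sum fun k _ => ?_
        refine le_trans ?_ (one_div_one_add_rpow_le hα (by positivity))
        have hk : 0 < ((k : ℕ) + 1 : ℝ) ^ α := by positivity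
        have hρk := hρ k
        rw [Real.rpow_neg (by positivity), ← div_eq_mul_inv, le_div_iff₀ hk] at hρk
        rw [Real.div_rpow (by positivity) hm.le, hmα,
          div_le_div_iff₀ (by linarith [h0 k]) (by positivity)]
        have : ρ k * (((k : ℕ) + 1 : ℝ) ^ α / (C₀ / lam)) ≤ lam := by
          rw [div_div_eq_mul_div, ← mul_div_assoc, div_le_iff₀ hC₀]
          nlinarith
        linarith
    _ ≤ 2 ^ α * (m / (α - 1)) := by
        rw [← Finset.mul_sum]
        gcongr
        exact sum_one_add_rpow_neg_le hα hm n
    _ = _ := by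
        rw [hm_def, Real.div_rpow hC₀.le hlam.le, Real.rpow_neg hlam.le]
        ring

/-! ### Tikhonov minimizer in eigencoordinates -/

theorem matApply_add {n : ℕ} (A : Matrix (Fin n) (Fin n) ℝ) (x y : EuclideanSpace ℝ (Fin n)) :
    matApply A (x + y) = matApply A x + matApply A y := by
  simp [matApply, Matrix.mulVec_add]

theorem matApply_sub {n : ℕ} (A : Matrix (Fin n) (Fin n) ℝ) (x y : EuclideanSpace ℝ (Fin n)) :
    matApply A (x - y) = matApply A x - matApply A y := by
  simp [matApply, Matrix.mulVec_sub]

theorem matApply_smul {n : ℕ} (A : Matrix (Fin n) (Fin n) ℝ) (t : ℝ)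
    (x : EuclideanSpace ℝ (Fin n)) : matApply A (t • x) = t • matApply A x := by
  simp [matApply, Matrix.mulVec_smul]

theorem wInner_sub_right {n : ℕ} (W : Matrix (Fin n) (Fin n) ℝ)
    (x y z : EuclideanSpace ℝ (Fin n)) : wInner W x (y - z) = wInner W x y - wInner W x z := by
  simp [wInner, Matrix.mulVec_sub, dotProduct_sub]

theorem Matrix.PosDef.wInner_comm {n : ℕ} {W : Matrix (Fin n) (Fin n) ℝ} (hW : W.PosDef)
    (x y : EuclideanSpace ℝ (Fin n)) : wInner W x y = wInner W y x :=
  Matrix.IsSymm.dotProduct_mulVec_comm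
    (by simpa [Matrix.IsHermitian, Matrix.IsSymm] using hW.isHermitian) _ _

theorem Matrix.PosDef.wNorm_sq {n : ℕ} {W : Matrix (Fin n) (Fin n) ℝ} (hW : W.PosDef)
    (x : EuclideanSpace ℝ (Fin n)) : wNorm W x ^ 2 = wInner W x x :=
  Real.sq_sqrt (by simpa [wInner] using hW.posSemidef.dotProduct_mulVec_nonneg x.ofLp)

theorem Matrix.PosDef.wInner_add_smul_self {n : ℕ} {W : Matrix (Fin n) (Fin n) ℝ} (hW : W.PosDef)
    (t : ℝ) (x v : EuclideanSpace ℝ (Fin n)) :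
    wInner W (x + t • v) (x + t • v) =
      wInner W x x + 2 * t * wInner W x v + t ^ 2 * wInner W v v := by
  have h := hW.wInner_comm v x
  simp only [wInner, WithLp.ofLp_add, WithLp.ofLp_smul, Matrix.mulVec_add, Matrix.mulVec_smul,
    dotProduct_add, add_dotProduct, dotProduct_smul, smul_dotProduct, smul_eq_mul] at h ⊢
  rw [h]
  ring

/-- Along `x + t • v` the increase of the functional is a nonnegative quadratic in `t` without
constant term, so its discriminant, the square of the linear coefficient, is at most zero. -/
theorem IsTikhonovMinimizer.normal_equation {n : ℕ} {A W : Matrix (Fin n) (Fin n) ℝ}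
    (hW : W.PosDef) {lam : ℝ} {b x : EuclideanSpace ℝ (Fin n)}
    (hx : IsTikhonovMinimizer A W lam b x) (v : EuclideanSpace ℝ (Fin n)) :
    inner ℝ (matApply A x - b) (matApply A v) + lam * wInner W x v = 0 := by
  have h : ∀ t : ℝ, 0 ≤ (‖matApply A v‖ ^ 2 + lam * wInner W v v) * (t * t) +
      (2 * (inner ℝ (matApply A x - b) (matApply A v) + lam * wInner W x v)) * t + 0 := by
    intro t
    have ht := hx (x + t • v)
    have hsplit : matApply A (x + t • v) - b = (matApply A x - b) + t • matApply A v := by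
      rw [matApply_add, matApply_smul]
      abel
    rw [tikhonov, tikhonov, hW.wNorm_sq, hW.wNorm_sq, hW.wInner_add_smul_self, hsplit,
      norm_add_sq_real, real_inner_smul_right, norm_smul, mul_pow, Real.norm_eq_abs, sq_abs] at ht
    linarith
  have hd := discrim_le_zero h
  rw [discrim] at hd
  nlinarith

section Coordinates

variable {n : ℕ} {A W : Matrix (Fin n) (Fin n) ℝ} {lam : ℝ} {u : Fin n → EuclideanSpace ℝ (Fin n)}
  {ν : Fin n → ℝ}

theorem IsTikhonovMinimizer.wInner_eigenvector (hW : W.PosDef)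
    (hu : ∀ k v, inner ℝ (matApply A (u k)) (matApply A v) = ν k * wInner W (u k) v)
    {xs e x : EuclideanSpace ℝ (Fin n)} (hx : IsTikhonovMinimizer A W lam (matApply A xs + e) x)
    (k : Fin n) :
    (ν k + lam) * wInner W (u k) x =
      ν k * wInner W (u k) xs + inner ℝ (matApply A (u k)) e := by
  have h := hx.normal_equation hW (u k)
  rw [real_inner_comm, inner_sub_right, inner_add_right, hu, hu, hW.wInner_comm x] at h
  linarith

theorem IsTikhonovMinimizer.norm_matApply_sub_sq_le (hW : W.PosDef) (hlam : 0 < lam)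
    (hu : ∀ k v, inner ℝ (matApply A (u k)) (matApply A v) = ν k * wInner W (u k) v)
    (hν : ∀ k, 0 ≤ ν k) (hWu : ∀ x, wInner W x x = ∑ k, wInner W (u k) x ^ 2)
    (hAu : ∀ x, ‖matApply A x‖ ^ 2 = ∑ k, ν k * wInner W (u k) x ^ 2)
    {xs e x : EuclideanSpace ℝ (Fin n)}
    (hx : IsTikhonovMinimizer A W lam (matApply A xs + e) x) :
    ‖matApply A x - matApply A xs‖ ^ 2 ≤ 2 * (lam * wNorm W xs ^ 2) +
      2 * ∑ k, inner ℝ ((√(ν k) / (ν k + lam)) • matApply A (u k)) e ^ 2 := by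
  rw [← matApply_sub, hAu, hW.wNorm_sq, hWu, Finset.mul_sum, Finset.mul_sum, Finset.mul_sum,
    ← Finset.sum_add_distrib]
  refine Finset.sum_le_sum fun k _ => ?_
  have hk := hx.wInner_eigenvector hW hu k
  have hpos : 0 < ν k + lam := by linarith [hν k]
  rw [wInner_sub_right, real_inner_smul_left, mul_pow, div_pow, Real.sq_sqrt (hν k)]
  set c := wInner W (u k) x
  set d := wInner W (u k) xs
  set g := inner ℝ (matApply A (u k)) e
  have hcd : c - d = (g - lam * d) / (ν k + lam) := by
    rw [eq_div_iff hpos.ne']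
    linarith
  have h1 : ν k * lam / (ν k + lam) ^ 2 ≤ 1 := by
    rw [div_le_one (by positivity)]
    nlinarith [hν k, sq_nonneg (ν k), sq_nonneg lam, mul_nonneg (hν k) hlam.le]
  calc ν k * (c - d) ^ 2 = ν k / (ν k + lam) ^ 2 * (g - lam * d) ^ 2 := by
        rw [hcd]
        field_simp
    _ ≤ ν k / (ν k + lam) ^ 2 * (2 * (lam * d) ^ 2 + 2 * g ^ 2) := by
        have := hν k
        gcongr
        nlinarith [sq_nonneg (g + lam * d)]
    _ = 2 * (ν k * lam / (ν k + lam) ^ 2 * (lam * d ^ 2)) +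
        2 * (ν k / (ν k + lam) ^ 2 * g ^ 2) := by ring
    _ ≤ _ := by
        gcongr ?_ + _
        exact mul_le_mul_of_nonneg_left (mul_le_of_le_one_left (by positivity) h1) two_pos.le

theorem IsTikhonovMinimizer.wNorm_sq_le (hW : W.PosDef) (hlam : 0 < lam)
    (hu : ∀ k v, inner ℝ (matApply A (u k)) (matApply A v) = ν k * wInner W (u k) v)
    (hν : ∀ k, 0 ≤ ν k) (hWu : ∀ x, wInner W x x = ∑ k, wInner W (u k) x ^ 2)
    {xs e x : EuclideanSpace ℝ (Fin n)}
    (hx : IsTikhonovMinimizer A W lam (matApply A xs + e) x) :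
    wNorm W x ^ 2 ≤ 2 * wNorm W xs ^ 2 +
      2 * ∑ k, inner ℝ ((1 / (ν k + lam)) • matApply A (u k)) e ^ 2 := by
  rw [hW.wNorm_sq, hW.wNorm_sq, hWu, hWu, Finset.mul_sum, Finset.mul_sum,
    ← Finset.sum_add_distrib]
  refine Finset.sum_le_sum fun k _ => ?_
  have hk := hx.wInner_eigenvector hW hu k
  have hpos : 0 < ν k + lam := by linarith [hν k]
  rw [real_inner_smul_left, mul_pow]
  set c := wInner W (u k) x
  set d := wInner W (u k) xs
  set g := inner ℝ (matApply A (u k)) e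
  have hc : c = ν k / (ν k + lam) * d + 1 / (ν k + lam) * g := by
    field_simp
    linarith
  have h0 : 0 ≤ ν k / (ν k + lam) := div_nonneg (hν k) hpos.le
  have h1 : ν k / (ν k + lam) ≤ 1 := by
    rw [div_le_one hpos]
    linarith
  calc c ^ 2 ≤ 2 * ((ν k / (ν k + lam)) ^ 2 * d ^ 2) + 2 * ((1 / (ν k + lam)) ^ 2 * g ^ 2) := by
        rw [hc]
        nlinarith [sq_nonneg (ν k / (ν k + lam) * d - 1 / (ν k + lam) * g)]
    _ ≤ _ := by
        gcongr
        exact mul_le_of_le_one_left (sq_nonneg d) (pow_le_one₀ h0 h1)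

theorem sum_norm_sq_filter_le (hν : ∀ k, ν k = ‖matApply A (u k)‖ ^ 2) (hlam : 0 < lam) :
    ∑ k, ‖(√(ν k) / (ν k + lam)) • matApply A (u k)‖ ^ 2 ≤ ∑ k, ν k / (ν k + lam) := by
  refine Finset.sum_le_sum fun k _ => ?_
  have h0 : 0 ≤ ν k := hν k ▸ sq_nonneg _
  have hpos : 0 < ν k + lam := by linarith
  rw [norm_smul, mul_pow, ← hν k, Real.norm_eq_abs, sq_abs, div_pow, Real.sq_sqrt h0,
    div_mul_eq_mul_div, div_le_div_iff₀ (by positivity) hpos]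
  have : 0 ≤ ν k * (ν k + lam) * lam := by positivity
  nlinarith

theorem sum_norm_sq_regularized_inverse_le (hν : ∀ k, ν k = ‖matApply A (u k)‖ ^ 2)
    (hlam : 0 < lam) :
    ∑ k, ‖(1 / (ν k + lam)) • matApply A (u k)‖ ^ 2 ≤ (∑ k, ν k / (ν k + lam)) / lam := by
  rw [Finset.sum_div]
  refine Finset.sum_le_sum fun k _ => ?_
  have h0 : 0 ≤ ν k := hν k ▸ sq_nonneg _
  have hpos : 0 < ν k + lam := by linarith
  rw [norm_smul, mul_pow, ← hν k, Real.norm_eq_abs, sq_abs, div_pow, one_pow,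
    div_mul_eq_mul_div, one_mul, div_div, sq]
  gcongr
  linarith

end Coordinates

/-! ### From bias and trace to the two tail bounds -/

theorem IsSubGaussianNoise.measureReal_scaled_ge_le {n : ℕ} (hn : 0 < n) {Ω : Type*}
    [MeasurableSpace Ω] {P : Measure Ω} [IsProbabilityMeasure P] {σ : ℝ≥0}
    {e : Ω → EuclideanSpace ℝ (Fin n)} (he : IsSubGaussianNoise P σ e) (hσ : 0 < σ)
    {b : Fin n → EuclideanSpace ℝ (Fin n)} {X : Ω → ℝ} {R S L C z : ℝ} (hR : 0 < R) (hL : 0 < L)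
    (hX : ∀ ω, X ω ^ 2 ≤ 2 * (R ^ 2 * n) + 2 * ∑ k, inner ℝ (b k) (e ω) ^ 2)
    (hS0 : 0 < S) (hS : ∑ k, ‖b k‖ ^ 2 ≤ S) (hSL : (σ : ℝ) ^ 2 * S ≤ L * (R ^ 2 * n))
    (hC2 : C ≤ Real.log 2 / 4) (hCL : C ≤ 3 / 32 / L) (hz : 0 ≤ z) :
    P.real {ω | R * z ≤ X ω / √n} ≤ 2 * Real.exp (-C * z ^ 2) := by
  have hσ' : (0 : ℝ) < σ := hσ
  have hn' : (0 : ℝ) < n := by exact_mod_cast hn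
  -- For `z < 2`, `C * z² ≤ log 2` makes the bound at least `1`. For `z ≥ 2` the bias term `2 R² n`
  -- is at most half of `R² n z²`, so the noise form must exceed `R² n z² / 4`.
  rcases lt_or_ge z 2 with hz2 | hz2
  · refine measureReal_le_one.trans ?_
    have h : Real.exp (-Real.log 2) ≤ Real.exp (-C * z ^ 2) := by
      rw [Real.exp_le_exp]
      have : C * z ^ 2 ≤ Real.log 2 / 4 * 2 ^ 2 := by gcongr
      linarith
    rw [Real.exp_neg, Real.exp_log two_pos] at h
    linarith
  · have hsub : {ω | R * z ≤ X ω / √n} ⊆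
        {ω | R ^ 2 * n * z ^ 2 / 4 ≤ ∑ k, inner ℝ (b k) (e ω) ^ 2} := by
      intro ω hω
      simp only [Set.mem_ofPred_eq] at hω ⊢
      have h1 : (R * z) ^ 2 ≤ (X ω / √n) ^ 2 := by gcongr
      rw [div_pow, Real.sq_sqrt hn'.le, le_div_iff₀ hn'] at h1
      have h2 := hX ω
      have h3 : 0 < R ^ 2 * n := by positivity
      nlinarith [mul_le_mul_of_nonneg_left (show (4 : ℝ) ≤ z ^ 2 by nlinarith) h3.le]
    refine (measureReal_mono hsub).trans
      ((he.measureReal_sum_inner_sq_ge_le hσ b hS (by positivity)).trans ?_)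
    gcongr
    rw [neg_mul, neg_le_neg_iff]
    calc C * z ^ 2 ≤ 3 / 32 / L * z ^ 2 := by gcongr
      _ = 3 / 8 * (R ^ 2 * n * z ^ 2 / 4 / (L * (R ^ 2 * n))) := by
          field_simp
          norm_num
      _ ≤ _ := by gcongr

theorem theorem3p1 (α C₀ M : ℝ) (hα : 1 < α) (hC₀ : 0 < C₀) (hM : 0 < M) :
    ∃ C : ℝ, 0 < C ∧
      ∀ (n : ℕ), 0 < n →
      ∀ (A W : Matrix (Fin n) (Fin n) ℝ), W.PosDef → EigenvalueDecay A W α C₀ →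
      ∀ (Ω : Type*) [MeasurableSpace Ω] (P : Measure Ω) [IsProbabilityMeasure P]
        (σ : ℝ≥0) (e : Ω → EuclideanSpace ℝ (Fin n)), 0 < σ → IsSubGaussianNoise P σ e →
      ∀ (xstar : EuclideanSpace ℝ (Fin n)) (lam : ℝ), 0 < lam →
        (σ : ℝ) / Real.sqrt n / rhoZero W xstar σ ≤ M * lam ^ (1 / 2 + 1 / (2 * α)) →
      ∀ (xlam : Ω → EuclideanSpace ℝ (Fin n)),
        (∀ ω, IsTikhonovMinimizer A W lam (matApply A xstar + e ω) (xlam ω)) →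
      ∀ z : ℝ, 0 ≤ z →
        P.real {ω | lam ^ (1 / 2 : ℝ) * rhoZero W xstar σ * z
            ≤ ‖matApply A (xlam ω) - matApply A xstar‖ / Real.sqrt n}
          ≤ 2 * Real.exp (-C * z ^ 2) ∧
        P.real {ω | rhoZero W xstar σ * z ≤ wNorm W (xlam ω) / Real.sqrt n}
          ≤ 2 * Real.exp (-C * z ^ 2) := by
  have hα1 : 0 < α - 1 := by linarith
  have hα0 : 0 < α := by linarith
  set K : ℝ := 2 ^ α * C₀ ^ (1 / α) / (α - 1) with hK_def
  have hK : 0 < K := by positivity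
  set L : ℝ := M ^ 2 * K with hL_def
  have hL : 0 < L := by positivity
  have hlog : 0 < Real.log 2 := Real.log_pos one_lt_two
  have hC : 0 < min (Real.log 2 / 4) (3 / 32 / L) := by positivity
  refine ⟨min (Real.log 2 / 4) (3 / 32 / L), hC, ?_⟩
  intro n hn A W hW hdecay Ω _ P _ σ e hσ he xs lam hlam hpar xlam hx z hz
  have hσ' : (0 : ℝ) < σ := hσ
  have hn' : (0 : ℝ) < n := by exact_mod_cast hn
  have hsn : 0 < √(n : ℝ) := Real.sqrt_pos.2 hn'
  set r := rhoZero W xs σ with hr_def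
  have hwn : 0 ≤ wNorm W xs := Real.sqrt_nonneg _
  have hrn : r * √n = wNorm W xs + σ := by
    rw [hr_def, rhoZero]
    field_simp
  have hr : 0 < r := pos_of_mul_pos_left (by rw [hrn]; positivity) hsn.le
  have hrsq : r ^ 2 * n = (wNorm W xs + σ) ^ 2 := by
    rw [← hrn, mul_pow, Real.sq_sqrt hn'.le]
  have hxs : wNorm W xs ^ 2 ≤ r ^ 2 * n := by
    rw [hrsq]
    gcongr
    linarith
  have hlp := Real.rpow_pos_of_pos hlam (-(1 / α))
  -- The squared parameter choice: the exponents satisfy `2 * (1/2 + 1/(2α)) - 1/α = 1`.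
  have hσsq : (σ : ℝ) ^ 2 * lam ^ (-(1 / α)) ≤ M ^ 2 * (lam * (r ^ 2 * n)) := by
    rw [div_div, div_le_iff₀ (by positivity)] at hpar
    calc (σ : ℝ) ^ 2 * lam ^ (-(1 / α))
        ≤ (M * lam ^ (1 / 2 + 1 / (2 * α)) * (√n * r)) ^ 2 * lam ^ (-(1 / α)) := by gcongr
      _ = M ^ 2 * ((lam ^ (1 / 2 + 1 / (2 * α))) ^ 2 * lam ^ (-(1 / α)) * (r ^ 2 * √n ^ 2)) := by
          ring
      _ = _ := by
          rw [Real.sq_sqrt hn'.le, ← Real.rpow_natCast (lam ^ _), ← Real.rpow_mul hlam.le,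
            ← Real.rpow_add hlam]
          have : (1 / 2 + 1 / (2 * α)) * ((2 : ℕ) : ℝ) + -(1 / α) = 1 := by
            push_cast
            field_simp
            ring
          rw [this, Real.rpow_one]
  obtain ⟨u, ν, hcard, hu, hνu, hWu, hAu⟩ := exists_genEigenbasis (A := A) hW
  have hν : ∀ k, 0 ≤ ν k := fun k => hνu k ▸ sq_nonneg _
  obtain ⟨ρ, ⟨-, hmult⟩, hρ⟩ := hdecay
  have hfiber : ∀ s, Nat.card {k // ρ k = s} = Nat.card {k // ν k = s} := fun s => by
    rw [hmult, hcard]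
  -- Every entry of `ρ` also occurs among the `ν k`, which are squared norms.
  have hρ0 : ∀ k, 0 ≤ ρ k := by
    intro k
    have : Nonempty {j // ρ j = ρ k} := ⟨⟨k, rfl⟩⟩
    have hpos : 0 < Nat.card {j // ν j = ρ k} := hfiber (ρ k) ▸ Nat.card_pos
    obtain ⟨j, hj⟩ := (Nat.card_pos_iff.1 hpos).1
    exact hj ▸ hν j
  have htrace : ∑ k, ν k / (ν k + lam) ≤ K * lam ^ (-(1 / α)) := by
    rw [← sum_comp_eq_of_card_fiber_eq hfiber fun s => s / (s + lam)]
    exact sum_div_add_le_of_decay hα hC₀ hlam hρ0 hρ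
  have hhalf : (lam ^ (1 / 2 : ℝ)) ^ 2 = lam := by
    rw [← Real.sqrt_eq_rpow, Real.sq_sqrt hlam.le]
  constructor
  · refine he.measureReal_scaled_ge_le hn hσ (by positivity) hL
      (b := fun k => (√(ν k) / (ν k + lam)) • matApply A (u k)) ?_
      (S := K * lam ^ (-(1 / α))) (by positivity)
      ((sum_norm_sq_filter_le hνu hlam).trans htrace) ?_ (min_le_left _ _) (min_le_right _ _) hz
    · intro ω
      refine ((hx ω).norm_matApply_sub_sq_le hW hlam hu hν hWu hAu).trans ?_
      rw [mul_pow, hhalf, mul_assoc lam]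
      gcongr
    · rw [mul_pow, hhalf, hL_def]
      nlinarith [mul_le_mul_of_nonneg_left hσsq hK.le]
  · refine he.measureReal_scaled_ge_le hn hσ hr hL
      (b := fun k => (1 / (ν k + lam)) • matApply A (u k)) ?_
      (S := K * lam ^ (-(1 / α)) / lam) (by positivity)
      ((sum_norm_sq_regularized_inverse_le hνu hlam).trans (by gcongr)) ?_ (min_le_left _ _)
      (min_le_right _ _) hz
    · intro ω
      refine ((hx ω).wNorm_sq_le hW hlam hu hν hWu).trans ?_
      gcongr
    · rw [← mul_div_assoc, div_le_iff₀ hlam, hL_def]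
      nlinarith [mul_le_mul_of_nonneg_left hσsq hK.le]
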